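/- Let $R$ be a commutative Noetherian local ring which is Gorenstein (that is, $R$ has finite injective dimension as a module over itself), and let $d=\dim R$ be its Krull dimension. For $R$-modules $M$ and $N$ put $$p^R(M,N)=\sup\{\, i\in\mathbb N \mid \operatorname{Ext}^i_R(M,N)\neq 0 \,\}\in\mathbb N\cup\{\infty\}$$ (with $\sup\emptyset=0$), and let $$\xi(R)=\sup\{\, p^R(M,N) \mid M \text{ a finitely generated } R\text{-module},\ N \text{ an arbitrary } R\text{-module},\ p^R(M,N)<\infty \,\}.$$ Assume that $\xi(R)<\infty$. Let $M$ be an $R$-module of finite length and let $N$ be an arbitrary $R$-module. If $\operatorname{Ext}^i_R(N,M)=0$ for all $i\gg 0$, then $\operatorname{Ext}^i_R(M,N)=0$ for all $i>d$. -/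

import Mathlib

open CategoryTheory

universe u

/-- A Gorenstein local ring: a Noetherian local ring which has finite injective dimension as a
module over itself. -/
class IsGorensteinLocalRing (R : Type u) [CommRing R] : Prop
    extends IsNoetherianRing R, IsLocalRing R where
  injectiveDimension_ne_top : injectiveDimension (ModuleCat.of R R) ≠ ⊤

/-- The number `p^R(M, N) = sup {i ∈ ℕ | Ext^i_R(M, N) ≠ 0}`, valued in `ℕ ∪ {∞}`.
(The supremum of the empty set is `0`.) -/
noncomputable def extSup (R : Type u) [CommRing R] (M N : Type u) [AddCommGroup M] [Module R M]
    [AddCommGroup N] [Module R N] : ℕ∞ :=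
  ⨆ (i : ℕ) (_ : Nontrivial (Abelian.Ext (ModuleCat.of R M) (ModuleCat.of R N) i)), (i : ℕ∞)

/-- The invariant `ξ(R)`: the supremum of the finite values of `p^R(M, N)`, where `M` runs over
the finitely generated `R`-modules and `N` runs over all `R`-modules. -/
noncomputable def xiInvariant (R : Type u) [CommRing R] : ℕ∞ :=
  ⨆ (M : ModuleCat.{u} R) (N : ModuleCat.{u} R) (_ : Module.Finite R M)
    (_ : extSup R M N < ⊤), extSup R M N

/-!
Write `k` for the residue field, `E` for its injective hull, `W = Hom(N, E)` and `X^* = Hom(X, R)`.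

By Matlis duality `M ≅ Hom(L, E)` with `L = Hom(M, E)` of finite length
(`nonempty_matlisBidual_equiv`), and `Ext^i(N, Hom(L, E))` and `Ext^i(L, W)` are both dual to
`Tor_i(L, N)`. Hence the hypothesis says that `Ext^i(L, W) = 0` for `i ≫ 0`
(`extVanishes_hom_swap`).

Let `X` be a high syzygy of `L`. Over a Gorenstein ring it is reflexive and has a complete
resolution, that is, it has cosyzygies of every order with the same properties
(`IsExtAcyclic.coresolution`). Replacing `X` by its `n`-th cosyzygy raises the degrees in which
`Ext(X, W)` lives by `n`. As these degrees are bounded by `ξ(R) < ∞` whenever there are finitely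
many of them, there are none (`IsExtAcyclic.extVanishes_of_xiInvariant`), and the complete
resolution `T` of `X` stays exact under `Hom(-, W)`. Now `Hom(T, W)` is the dual of `T ⊗ N`, which
is `Hom(T^*, N)`, and duals into `E` detect exactness; so `Ext^i(X^*, N) = 0` for `i > 0`
(`IsExtAcyclic.extVanishes_dual`).

Finally let `r` be the injective dimension of `R`. It equals the depth and is at most `d`
(`exists_injectiveDimension_eq_depth`), so that `Ext^i(L, R)` is nonzero at most for `i = r`.
Dualizing the first `r` steps of a free resolution of `L` therefore shows that `Ext^r(L, R)` is the
cokernel of a map from a module of projective dimension less than `r` into the dual of the `r`-th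
syzygy, whence `Ext^i(Ext^r(L, R), N) = 0` for `i > r` (`extVanishes_extModule`). On the other hand
`Ext^r(L, R) = Hom(L, C)`, where `C` is the last term of a minimal injective resolution of `R`
(`exists_cosyzygy`). Since `k` embeds in `C`, the module `E` is a direct summand of `C`, and
`M ≅ Hom(L, E)` is a direct summand of `Ext^r(L, R)`.
-/

/-! ### Vanishing of `Ext` for unbundled modules -/

section ExtVanishing

variable {R : Type u} [CommRing R]

/-- Vanishing of `Ext^i_R(X, Y)`, for unbundled modules. -/
abbrev ExtVanishes (R : Type u) [CommRing R] (X Y : Type u) [AddCommGroup X] [Module R X]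
    [AddCommGroup Y] [Module R Y] (i : ℕ) : Prop :=
  Subsingleton (Abelian.Ext (ModuleCat.of R X) (ModuleCat.of R Y) i)

variable {A B C X Y : Type u} [AddCommGroup A] [Module R A] [AddCommGroup B] [Module R B]
  [AddCommGroup C] [Module R C] [AddCommGroup X] [Module R X] [AddCommGroup Y] [Module R Y]

/-- A short exact sequence `0 → A → B → C → 0` of unbundled modules, given by its two maps. -/
structure ShortExactMaps (f : A →ₗ[R] B) (g : B →ₗ[R] C) : Prop where
  injective : Function.Injective f
  exact : Function.Exact f g
  surjective : Function.Surjective g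

lemma shortExactMaps_ker {g : B →ₗ[R] C} (hg : Function.Surjective g) :
    ShortExactMaps (LinearMap.ker g).subtype g :=
  ⟨Subtype.val_injective, LinearMap.exact_subtype_ker_map g, hg⟩

lemma shortExactMaps_mkQ {f : A →ₗ[R] B} (hf : Function.Injective f) :
    ShortExactMaps f (LinearMap.range f).mkQ :=
  ⟨hf, LinearMap.exact_map_mkQ_range f, Submodule.mkQ_surjective _⟩

namespace ShortExactMaps

variable {f : A →ₗ[R] B} {g : B →ₗ[R] C} (h : ShortExactMaps f g)
include h

lemma shortComplex_shortExact :
    (ShortComplex.mk (ModuleCat.ofHom f) (ModuleCat.ofHom g)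
      (by ext x; exact h.exact.apply_apply_eq_zero x)).ShortExact :=
  ModuleCat.shortComplex_shortExact _ h.exact h.injective h.surjective

-- The next lemmas read off vanishing from the long exact sequences of `Ext`, in the first variable
-- and (primed) in the second one; the suffix names the term of `0 → A → B → C → 0` that is
-- concluded about.
lemma extVanishes_mid {i : ℕ} (hA : ExtVanishes R A Y i) (hC : ExtVanishes R C Y i) :
    ExtVanishes R B Y i := by
  refine subsingleton_of_forall_eq 0 fun x ↦ ?_
  obtain ⟨y, rfl⟩ := Abelian.Ext.contravariant_sequence_exact₂ h.shortComplex_shortExact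
    (ModuleCat.of R Y) x (hA.elim _ _)
  rw [show y = 0 from hC.elim _ _, Abelian.Ext.comp_zero]

lemma extVanishes_right {i : ℕ} (hA : ExtVanishes R A Y i) (hB : ExtVanishes R B Y (i + 1)) :
    ExtVanishes R C Y (i + 1) := by
  refine subsingleton_of_forall_eq 0 fun x ↦ ?_
  obtain ⟨y, rfl⟩ := Abelian.Ext.contravariant_sequence_exact₃ h.shortComplex_shortExact
    (ModuleCat.of R Y) x (hB.elim _ _) (add_comm 1 i)
  rw [show y = 0 from hA.elim _ _, Abelian.Ext.comp_zero]

lemma extVanishes_left {i : ℕ} (hB : ExtVanishes R B Y i) (hC : ExtVanishes R C Y (i + 1)) :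
    ExtVanishes R A Y i := by
  refine subsingleton_of_forall_eq 0 fun x ↦ ?_
  obtain ⟨y, rfl⟩ := Abelian.Ext.contravariant_sequence_exact₁ h.shortComplex_shortExact
    (ModuleCat.of R Y) x (add_comm 1 i) (hC.elim _ _)
  rw [show y = 0 from hB.elim _ _, Abelian.Ext.comp_zero]

lemma extVanishes_left' {i : ℕ} (hC : ExtVanishes R X C i) (hB : ExtVanishes R X B (i + 1)) :
    ExtVanishes R X A (i + 1) := by
  refine subsingleton_of_forall_eq 0 fun x ↦ ?_
  obtain ⟨y, rfl⟩ := Abelian.Ext.covariant_sequence_exact₁ (ModuleCat.of R X)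
    h.shortComplex_shortExact x (hB.elim _ _) rfl
  rw [show y = 0 from hC.elim _ _, Abelian.Ext.zero_comp]

lemma extVanishes_right' {i : ℕ} (hB : ExtVanishes R X B i) (hA : ExtVanishes R X A (i + 1)) :
    ExtVanishes R X C i := by
  refine subsingleton_of_forall_eq 0 fun x ↦ ?_
  obtain ⟨y, rfl⟩ := Abelian.Ext.covariant_sequence_exact₃ (ModuleCat.of R X)
    h.shortComplex_shortExact x rfl (hA.elim _ _)
  rw [show y = 0 from hB.elim _ _, Abelian.Ext.zero_comp]

end ShortExactMaps

lemma ExtVanishes.of_retract {i : ℕ} (hX : ExtVanishes R X Y i) (s : A →ₗ[R] X) (p : X →ₗ[R] A)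
    (hps : p ∘ₗ s = LinearMap.id) : ExtVanishes R A Y i := by
  refine subsingleton_of_forall_eq 0 fun x ↦ ?_
  have h1 : ModuleCat.ofHom s ≫ ModuleCat.ofHom p = 𝟙 _ := by
    rw [← ModuleCat.ofHom_comp, hps]; rfl
  rw [← Abelian.Ext.mk₀_id_comp x, ← h1, ← Abelian.Ext.mk₀_comp_mk₀_assoc,
    show (Abelian.Ext.mk₀ (ModuleCat.ofHom p)).comp x (zero_add i) = 0 from hX.elim _ _,
    Abelian.Ext.comp_zero]

lemma ExtVanishes.of_retract' {i : ℕ} (hX : ExtVanishes R Y X i) (s : A →ₗ[R] X) (p : X →ₗ[R] A)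
    (hps : p ∘ₗ s = LinearMap.id) : ExtVanishes R Y A i := by
  refine subsingleton_of_forall_eq 0 fun x ↦ ?_
  have h1 : ModuleCat.ofHom s ≫ ModuleCat.ofHom p = 𝟙 _ := by
    rw [← ModuleCat.ofHom_comp, hps]; rfl
  rw [← Abelian.Ext.comp_mk₀_id x, ← h1, ← Abelian.Ext.mk₀_comp_mk₀,
    ← Abelian.Ext.comp_assoc (a₁₂ := i) (a₂₃ := 0) (a := i) _ _ _ (add_zero i) (add_zero 0)
      (by simp),
    show x.comp (Abelian.Ext.mk₀ (ModuleCat.ofHom s)) (add_zero i) = 0 from hX.elim _ _,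
    Abelian.Ext.zero_comp]

lemma ExtVanishes.congr_left {i : ℕ} (hX : ExtVanishes R X Y i) (e : X ≃ₗ[R] A) :
    ExtVanishes R A Y i :=
  hX.of_retract e.symm.toLinearMap e.toLinearMap (by ext; simp)

lemma ExtVanishes.congr_right {i : ℕ} (hX : ExtVanishes R Y X i) (e : X ≃ₗ[R] A) :
    ExtVanishes R Y A i :=
  hX.of_retract' e.symm.toLinearMap e.toLinearMap (by ext; simp)

lemma extVanishes_of_projective [Module.Projective R X] (i : ℕ) : ExtVanishes R X Y (i + 1) := by
  have : Projective (ModuleCat.of R X) := (IsProjective.iff_projective (R := R) X).mp inferInstance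
  exact Abelian.Ext.subsingleton_of_projective _ _ i

lemma extVanishes_of_injective [Module.Injective R Y] (i : ℕ) : ExtVanishes R X Y (i + 1) := by
  have : Injective (ModuleCat.of R Y) := Module.injective_object_of_injective_module R Y
  exact Abelian.Ext.subsingleton_of_injective _ _ i

lemma extVanishes_of_subsingleton [Subsingleton X] (i : ℕ) : ExtVanishes R X Y i := by
  refine subsingleton_of_forall_eq 0 fun x ↦ ?_
  rw [← Abelian.Ext.mk₀_id_comp x, show 𝟙 (ModuleCat.of R X) = 0 by
    ext; exact Subsingleton.elim (α := X) _ _, Abelian.Ext.mk₀_zero, Abelian.Ext.zero_comp]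

/-- In degree zero, `Ext` is the module of linear maps. -/
noncomputable def extZeroEquiv (R : Type u) [CommRing R] (X Y : Type u) [AddCommGroup X]
    [Module R X] [AddCommGroup Y] [Module R Y] :
    Abelian.Ext (ModuleCat.of R X) (ModuleCat.of R Y) 0 ≃ₗ[R] (X →ₗ[R] Y) :=
  Abelian.Ext.linearEquiv₀.trans ModuleCat.homLinearEquiv

lemma extVanishes_zero_iff : ExtVanishes R X Y 0 ↔ Subsingleton (X →ₗ[R] Y) :=
  (extZeroEquiv R X Y).toEquiv.subsingleton_congr

namespace ShortExactMaps

variable {f : A →ₗ[R] B} {g : B →ₗ[R] C} (h : ShortExactMaps f g)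
include h

lemma exists_extension (hC : ExtVanishes R C Y 1) (φ : A →ₗ[R] Y) :
    ∃ ψ : B →ₗ[R] Y, ψ ∘ₗ f = φ := by
  obtain ⟨y, hy⟩ := Abelian.Ext.contravariant_sequence_exact₁ h.shortComplex_shortExact
    (ModuleCat.of R Y) (Abelian.Ext.mk₀ (ModuleCat.ofHom φ)) (add_comm 1 0) (hC.elim _ _)
  obtain ⟨ψ, rfl⟩ := (Abelian.Ext.mk₀_bijective _ _).2 y
  rw [Abelian.Ext.mk₀_comp_mk₀] at hy
  refine ⟨ψ.hom, ?_⟩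
  simpa using congrArg ModuleCat.Hom.hom ((Abelian.Ext.mk₀_bijective _ _).1 hy)

lemma exists_lift (hA : ExtVanishes R X A 1) (φ : X →ₗ[R] C) :
    ∃ ψ : X →ₗ[R] B, g ∘ₗ ψ = φ := by
  obtain ⟨y, hy⟩ := Abelian.Ext.covariant_sequence_exact₃ (ModuleCat.of R X)
    h.shortComplex_shortExact (Abelian.Ext.mk₀ (ModuleCat.ofHom φ)) (zero_add 1) (hA.elim _ _)
  obtain ⟨ψ, rfl⟩ := (Abelian.Ext.mk₀_bijective _ _).2 y
  rw [Abelian.Ext.mk₀_comp_mk₀] at hy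
  refine ⟨ψ.hom, ?_⟩
  simpa using congrArg ModuleCat.Hom.hom ((Abelian.Ext.mk₀_bijective _ _).1 hy)

/-- The connecting map `Hom(A, Y) → Ext^1(C, Y)`, whose kernel consists of the maps that extend
to `B`. -/
lemma exists_connecting (hB : ExtVanishes R B Y 1) :
    ∃ δ : (A →ₗ[R] Y) →ₗ[R] Abelian.Ext (ModuleCat.of R C) (ModuleCat.of R Y) 1,
      Function.Surjective δ ∧ ∀ φ, δ φ = 0 ↔ ∃ ψ : B →ₗ[R] Y, ψ ∘ₗ f = φ := by
  let δ := h.shortComplex_shortExact.extClass.precompOfLinear R (ModuleCat.of R Y) (add_comm 1 0)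
  have hδ : ∀ φ : A →ₗ[R] Y, (extZeroEquiv R A Y).symm φ = Abelian.Ext.mk₀ (ModuleCat.ofHom φ) :=
    fun φ ↦ rfl
  refine ⟨δ ∘ₗ (extZeroEquiv R A Y).symm.toLinearMap, fun x ↦ ?_, fun φ ↦ ⟨fun hφ ↦ ?_, ?_⟩⟩
  · obtain ⟨y, hy⟩ := Abelian.Ext.contravariant_sequence_exact₃ h.shortComplex_shortExact
      (ModuleCat.of R Y) x (hB.elim _ _) (add_comm 1 0)
    obtain ⟨φ, rfl⟩ := (Abelian.Ext.mk₀_bijective _ _).2 y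
    refine ⟨φ.hom, ?_⟩
    rw [LinearMap.comp_apply, LinearEquiv.coe_coe, hδ]
    exact hy
  · obtain ⟨y, hy⟩ := Abelian.Ext.contravariant_sequence_exact₁ h.shortComplex_shortExact
      (ModuleCat.of R Y) ((extZeroEquiv R A Y).symm φ) (add_comm 1 0) hφ
    obtain ⟨ψ, rfl⟩ := (Abelian.Ext.mk₀_bijective _ _).2 y
    rw [Abelian.Ext.mk₀_comp_mk₀, hδ] at hy
    refine ⟨ψ.hom, ?_⟩
    simpa using congrArg ModuleCat.Hom.hom ((Abelian.Ext.mk₀_bijective _ _).1 hy)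
  · rintro ⟨ψ, rfl⟩
    have : (extZeroEquiv R A Y).symm (ψ ∘ₗ f) = (Abelian.Ext.mk₀ (ModuleCat.ofHom f)).comp
        (Abelian.Ext.mk₀ (ModuleCat.ofHom ψ)) (zero_add 0) := by
      rw [Abelian.Ext.mk₀_comp_mk₀, hδ]
      rfl
    rw [LinearMap.comp_apply, LinearEquiv.coe_coe, this]
    have key := h.shortComplex_shortExact.extClass_comp_assoc
      (Abelian.Ext.mk₀ (ModuleCat.ofHom ψ)) (h := add_comm 1 0)
    exact key

lemma extVanishes_one_of_extension (hB : ExtVanishes R B Y 1)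
    (H : ∀ φ : A →ₗ[R] Y, ∃ ψ : B →ₗ[R] Y, ψ ∘ₗ f = φ) : ExtVanishes R C Y 1 := by
  obtain ⟨δ, hδ, hδ'⟩ := h.exists_connecting hB
  refine subsingleton_of_forall_eq 0 fun x ↦ ?_
  obtain ⟨φ, rfl⟩ := hδ x
  exact (hδ' φ).mpr (H φ)

/-- The contravariant connecting map is an isomorphism when the two neighbouring `Ext` modules of
the middle term vanish. -/
lemma nonempty_extEquiv {i : ℕ} (hB : ExtVanishes R B Y i) (hB' : ExtVanishes R B Y (i + 1)) :
    Nonempty (Abelian.Ext (ModuleCat.of R A) (ModuleCat.of R Y) i ≃ₗ[R]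
      Abelian.Ext (ModuleCat.of R C) (ModuleCat.of R Y) (i + 1)) := by
  refine ⟨LinearEquiv.ofBijective
    (h.shortComplex_shortExact.extClass.precompOfLinear R (ModuleCat.of R Y) (add_comm 1 i))
    ⟨?_, ?_⟩⟩
  · rw [injective_iff_map_eq_zero]
    intro x hx
    obtain ⟨y, rfl⟩ := Abelian.Ext.contravariant_sequence_exact₁ h.shortComplex_shortExact
      (ModuleCat.of R Y) x (add_comm 1 i) hx
    rw [show y = 0 from hB.elim _ _, Abelian.Ext.comp_zero]
  · intro x
    exact Abelian.Ext.contravariant_sequence_exact₃ h.shortComplex_shortExact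
      (ModuleCat.of R Y) x (hB'.elim _ _) (add_comm 1 i)

/-- The covariant connecting map is an isomorphism when the two neighbouring `Ext` modules of
the middle term vanish. -/
lemma nonempty_extEquiv' {i : ℕ} (hB : ExtVanishes R X B i) (hB' : ExtVanishes R X B (i + 1)) :
    Nonempty (Abelian.Ext (ModuleCat.of R X) (ModuleCat.of R C) i ≃ₗ[R]
      Abelian.Ext (ModuleCat.of R X) (ModuleCat.of R A) (i + 1)) := by
  refine ⟨LinearEquiv.ofBijective
    (h.shortComplex_shortExact.extClass.postcompOfLinear R (ModuleCat.of R X) rfl) ⟨?_, ?_⟩⟩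
  · rw [injective_iff_map_eq_zero]
    intro x hx
    obtain ⟨y, rfl⟩ := Abelian.Ext.covariant_sequence_exact₃ (ModuleCat.of R X)
      h.shortComplex_shortExact x rfl hx
    rw [show y = 0 from hB.elim _ _, Abelian.Ext.zero_comp]
  · intro x
    exact Abelian.Ext.covariant_sequence_exact₁ (ModuleCat.of R X)
      h.shortComplex_shortExact x (hB'.elim _ _) rfl

end ShortExactMaps

end ExtVanishing

/-! ### Injective hulls and Matlis duality -/

section InjectiveHull

variable {R : Type u} [CommRing R]

lemma injective_of_retract {I E : Type u} [AddCommGroup I] [Module R I] [AddCommGroup E]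
    [Module R E] [Module.Injective R I] (s : E →ₗ[R] I) (p : I →ₗ[R] E)
    (hps : p ∘ₗ s = LinearMap.id) : Module.Injective R E := by
  refine ⟨fun X Y _ _ _ _ f hf g ↦ ?_⟩
  obtain ⟨h, hh⟩ := Module.Injective.out f hf (s ∘ₗ g)
  refine ⟨p ∘ₗ h, fun x ↦ ?_⟩
  simpa [hh] using LinearMap.congr_fun hps (g x)

lemma exists_injective_embedding (R : Type u) [CommRing R] (C : Type u) [AddCommGroup C]
    [Module R C] : ∃ (I : ModuleCat.{u} R) (f : C →ₗ[R] I),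
      Function.Injective f ∧ Module.Injective R I := by
  let J := Injective.under (ModuleCat.of R C)
  have : Injective (ModuleCat.of R J) := inferInstanceAs (Injective J)
  exact ⟨J, (Injective.ι (ModuleCat.of R C)).hom, (ModuleCat.mono_iff_injective _).mp inferInstance,
    Module.injective_module_of_injective_object R J⟩

/-- A linear map is essential if every nonzero submodule of its target meets its range. -/
def IsEssentialMap {C E : Type u} [AddCommGroup C] [Module R C] [AddCommGroup E] [Module R E]
    (j : C →ₗ[R] E) : Prop :=
  ∀ S : Submodule R E, Disjoint S (LinearMap.range j) → S = ⊥

/-- Existence of injective hulls: inside an injective module `I` containing `C`, a maximal essential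
extension `E` of `C` is a direct summand of `I`. -/
theorem exists_injective_hull (R : Type u) [CommRing R] (C : Type u) [AddCommGroup C] [Module R C] :
    ∃ (E : ModuleCat.{u} R) (j : C →ₗ[R] E),
      Function.Injective j ∧ Module.Injective R E ∧ IsEssentialMap j := by
  obtain ⟨I, f, hf, hI⟩ := exists_injective_embedding R C
  let C₀ := LinearMap.range f
  obtain ⟨E, hCE, hE⟩ := zorn_le_nonempty₀
    {E : Submodule R I | C₀ ≤ E ∧ ∀ S ≤ E, Disjoint S C₀ → S = ⊥} (by
      intro c hc hchain y hy
      have hdir : DirectedOn (· ≤ ·) c := hchain.directedOn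
      refine ⟨sSup c, ⟨(hc hy).1.trans (le_sSup hy), fun S hS hd ↦ ?_⟩, fun z hz ↦ le_sSup hz⟩
      rw [eq_bot_iff]
      intro x hx
      obtain ⟨E, hEc, hxE⟩ := (Submodule.mem_sSup_of_directed ⟨y, hy⟩ hdir).mp (hS hx)
      have := (hc hEc).2 (R ∙ x) ((Submodule.span_singleton_le_iff_mem _ _).mpr hxE)
        (hd.mono_left ((Submodule.span_singleton_le_iff_mem _ _).mpr hx))
      simpa using this) C₀ ⟨le_rfl, fun S hS hd ↦ disjoint_self.mp (hd.mono_right hS)⟩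
  -- `U` is maximal among the submodules that meet `E` trivially, so `E → I / U` is essential
  obtain ⟨U, -, hU⟩ := zorn_le_nonempty₀ {U : Submodule R I | Disjoint U E} (by
      intro c hc hchain y hy
      refine ⟨sSup c, ?_, fun z hz ↦ le_sSup hz⟩
      exact (hchain.directedOn.disjoint_sSup_left).mpr fun U hU ↦ hc hU) ⊥ disjoint_bot_left
  have hEU : Disjoint U E := hU.prop
  have hess : ∀ T : Submodule R (I ⧸ U), Disjoint T (E.map U.mkQ) → T = ⊥ := by
    intro T hT
    have h1 : Disjoint (T.comap U.mkQ) E := by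
      rw [Submodule.disjoint_def] at hT hEU ⊢
      intro x hx hxE
      have := hT _ hx (Submodule.mem_map_of_mem hxE)
      exact hEU x (by simpa using this) hxE
    have h2 : T.comap U.mkQ ≤ U := hU.le_of_ge h1 (by
      intro x hx
      simp [(Submodule.Quotient.mk_eq_zero U).mpr hx])
    rw [eq_bot_iff]
    intro t ht
    obtain ⟨x, rfl⟩ := U.mkQ_surjective t
    simpa using h2 ht
  obtain ⟨g, hg⟩ := Module.Injective.out (U.mkQ ∘ₗ E.subtype) (by
    rw [← LinearMap.ker_eq_bot, LinearMap.ker_eq_bot']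
    intro x hx
    have := Submodule.disjoint_def.mp hEU x (by simpa using hx) x.2
    simpa using this) E.subtype
  have hg' : ∀ x ∈ E, g (U.mkQ x) = x := fun x hx ↦ hg ⟨x, hx⟩
  have hdisj : ∀ S : Submodule R I, Disjoint S E → S.comap g = ⊥ := by
    intro S hS
    refine hess _ (Submodule.disjoint_def.mpr ?_)
    rintro _ h1 ⟨x, hx, rfl⟩
    have h2 : g (U.mkQ x) ∈ S := h1
    rw [hg' x hx] at h2
    simp [Submodule.disjoint_def.mp hS x h2 hx]
  -- `g` embeds `I / U` in `I` as an essential extension of `E`, so its range is `E` by maximality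
  have hle : E ≤ LinearMap.range g := fun x hx ↦ ⟨_, hg' x hx⟩
  have hrange : LinearMap.range g ≤ E := by
    refine hE.le_of_ge ⟨hCE.trans hle, fun S hS hd ↦ ?_⟩ hle
    have h1 : S ⊓ E = ⊥ := hE.prop.2 _ inf_le_right (hd.mono_left inf_le_left)
    have h2 := hdisj S (disjoint_iff.mpr h1)
    rw [eq_bot_iff]
    intro x hx
    obtain ⟨y, rfl⟩ := hS hx
    have : y ∈ S.comap g := hx
    rw [h2, Submodule.mem_bot] at this
    simp [this]
  let ρ : I →ₗ[R] E := (g ∘ₗ U.mkQ).codRestrict E fun x ↦ hrange ⟨_, rfl⟩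
  have hρ : ρ ∘ₗ E.subtype = LinearMap.id := by
    ext x
    exact hg' x x.2
  let j : C →ₗ[R] E := f.codRestrict E fun x ↦ hCE ⟨x, rfl⟩
  refine ⟨ModuleCat.of R E, j, fun x y hxy ↦ hf (congrArg Subtype.val hxy),
    injective_of_retract E.subtype ρ hρ, fun S hS ↦ ?_⟩
  have := hE.prop.2 (S.map E.subtype) (Submodule.map_subtype_le E S) (by
    rw [Submodule.disjoint_def] at hS ⊢
    rintro _ ⟨x, hx, rfl⟩ ⟨c, hc⟩
    have := hS x hx ⟨c, Subtype.ext hc⟩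
    simp [this])
  exact Submodule.map_injective_of_injective E.injective_subtype
    (this.trans (Submodule.map_bot _).symm)

lemma IsEssentialMap.injective_of_comp {C E X : Type u} [AddCommGroup C] [Module R C]
    [AddCommGroup E] [Module R E] [AddCommGroup X] [Module R X] {j : C →ₗ[R] E}
    (hj : IsEssentialMap j) (φ : E →ₗ[R] X) (h : Function.Injective (φ ∘ₗ j)) :
    Function.Injective φ := by
  rw [← LinearMap.ker_eq_bot]
  refine hj _ (Submodule.disjoint_def.mpr ?_)
  rintro _ hx ⟨c, rfl⟩
  have : c = 0 := h (by simpa using hx)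
  simp [this]

end InjectiveHull

section Duality

variable {R : Type u} [CommRing R]

variable {A B C X Y E : Type u} [AddCommGroup A] [Module R A] [AddCommGroup B] [Module R B]
  [AddCommGroup C] [Module R C] [AddCommGroup X] [Module R X] [AddCommGroup Y] [Module R Y]
  [AddCommGroup E] [Module R E]

lemma ShortExactMaps.exists_factor {f : A →ₗ[R] B} {g : B →ₗ[R] C} (h : ShortExactMaps f g)
    (φ : B →ₗ[R] E) (hφ : φ ∘ₗ f = 0) : ∃ ψ : C →ₗ[R] E, ψ ∘ₗ g = φ := by
  have hker : LinearMap.ker g ≤ LinearMap.ker φ := by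
    intro b hb
    obtain ⟨a, rfl⟩ := (h.exact b).mp hb
    exact LinearMap.congr_fun hφ a
  refine ⟨(LinearMap.ker g).liftQ φ hker ∘ₗ
    (g.quotKerEquivOfSurjective h.surjective).symm.toLinearMap, ?_⟩
  ext b
  have : (g.quotKerEquivOfSurjective h.surjective).symm (g b) = (LinearMap.ker g).mkQ b := by
    rw [LinearEquiv.symm_apply_eq]; rfl
  simp [this]

/-- If every map `A → E` extends to `B`, then `Hom(-, E)` preserves exactness of
`0 → A → B → C → 0`. -/
lemma ShortExactMaps.lcomp {f : A →ₗ[R] B} {g : B →ₗ[R] C} (h : ShortExactMaps f g)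
    (hext : ∀ φ : A →ₗ[R] E, ∃ ψ : B →ₗ[R] E, ψ ∘ₗ f = φ) :
    ShortExactMaps (LinearMap.lcomp R E g) (LinearMap.lcomp R E f) := by
  refine ⟨fun φ ψ hφ ↦ ?_, fun φ ↦ ⟨fun hφ ↦ ?_, ?_⟩, hext⟩
  · ext c
    obtain ⟨b, rfl⟩ := h.surjective c
    exact LinearMap.congr_fun hφ b
  · exact h.exists_factor φ hφ
  · rintro ⟨ψ, rfl⟩
    ext a
    simp [h.exact.apply_apply_eq_zero]

lemma ShortExactMaps.lcomp_of_injective [Module.Injective R E] {f : A →ₗ[R] B} {g : B →ₗ[R] C}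
    (h : ShortExactMaps f g) :
    ShortExactMaps (LinearMap.lcomp R E g) (LinearMap.lcomp R E f) := by
  refine h.lcomp fun φ ↦ ?_
  obtain ⟨ψ, hψ⟩ := Module.Injective.out f h.injective φ
  exact ⟨ψ, LinearMap.ext hψ⟩

/-- `Hom(-, Hom(X, E)) = Hom(X, Hom(-, E))` is a composition of exact functors. -/
lemma injective_hom_of_projective [Module.Projective R X] [Module.Injective R E] :
    Module.Injective R (X →ₗ[R] E) := by
  refine ⟨fun A B _ _ _ _ f hf g ↦ ?_⟩
  have hs : Function.Surjective (LinearMap.lcomp R E f) :=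
    (shortExactMaps_mkQ hf).lcomp_of_injective.surjective
  obtain ⟨h, hh⟩ := Module.projective_lifting_property (LinearMap.lcomp R E f) g.flip hs
  refine ⟨h.flip, fun a ↦ ?_⟩
  ext x
  exact LinearMap.congr_fun (LinearMap.congr_fun hh x) a

/-- For `E` injective, `Ext^i(Y, Hom(X, E))` and `Ext^i(X, Hom(Y, E))` are both dual to
`Tor_i(X, Y)`; here only the resulting comparison of their vanishing is recorded, and it is proved
by shifting dimensions down to degree one. -/
lemma extVanishes_hom_swap [Module.Injective R E] (i : ℕ)
    (hV : ExtVanishes R Y (X →ₗ[R] E) (i + 1)) : ExtVanishes R X (Y →ₗ[R] E) (i + 1) := by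
  induction i generalizing X with
  | zero =>
    have hπ := shortExactMaps_ker (Finsupp.linearCombination_id_surjective R X)
    refine hπ.extVanishes_one_of_extension (extVanishes_of_projective 0) fun φ ↦ ?_
    obtain ⟨ψ, hψ⟩ := (hπ.lcomp_of_injective (E := E)).exists_lift hV φ.flip
    refine ⟨ψ.flip, ?_⟩
    ext a y
    exact LinearMap.congr_fun (LinearMap.congr_fun hψ y) a
  | succ i ih =>
    have hπ := shortExactMaps_ker (Finsupp.linearCombination_id_surjective R X)
    have : Module.Injective R ((X →₀ R) →ₗ[R] E) := injective_hom_of_projective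
    exact hπ.extVanishes_right (ih ((hπ.lcomp_of_injective (E := E)).extVanishes_right'
      (extVanishes_of_injective i) hV)) (extVanishes_of_projective _)

end Duality

section MatlisDuality

variable {R : Type u} [CommRing R] [IsLocalRing R]

open IsLocalRing

instance isSimpleModule_quotient_maximalIdeal : IsSimpleModule R (R ⧸ maximalIdeal R) :=
  isSimpleModule_iff_quot_maximal.mpr ⟨_, inferInstance, ⟨LinearEquiv.refl _ _⟩⟩

variable {E : Type u} [AddCommGroup E] [Module R E] [Module.Injective R E]
  {j : (R ⧸ maximalIdeal R) →ₗ[R] E}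

/-- The injective hull of the residue field of a local ring is a cogenerator. -/
lemma exists_functional_ne_zero (hj : Function.Injective j) {X : Type u} [AddCommGroup X]
    [Module R X] {x : X} (hx : x ≠ 0) : ∃ l : X →ₗ[R] E, l x ≠ 0 := by
  let τ := LinearMap.toSpanSingleton R X x
  have hle : LinearMap.ker τ ≤ maximalIdeal R := by
    refine le_maximalIdeal fun h ↦ hx ?_
    have : (1 : R) ∈ LinearMap.ker τ := by rw [h]; trivial
    simpa [τ] using this
  obtain ⟨l, hl⟩ := Module.Injective.out ((LinearMap.ker τ).liftQ τ le_rfl)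
    (LinearMap.ker_eq_bot.mp (Submodule.ker_liftQ_eq_bot _ _ _ le_rfl))
    (j ∘ₗ Submodule.factor hle)
  refine ⟨l, fun h0 ↦ ?_⟩
  have h1 := hl (Submodule.Quotient.mk 1)
  simp only [Submodule.liftQ_apply, τ, LinearMap.toSpanSingleton_apply, one_smul, h0] at h1
  have h2 : (Submodule.Quotient.mk 1 : R ⧸ maximalIdeal R) = 0 := hj (by simpa using h1.symm)
  rw [Submodule.Quotient.mk_eq_zero] at h2
  exact (Ideal.ne_top_iff_one _).mp (maximalIdeal.isMaximal R).ne_top h2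

lemma exists_functional_separating (hj : Function.Injective j) {X : Type u} [AddCommGroup X]
    [Module R X] (S : Submodule R X) {x : X} (hx : x ∉ S) :
    ∃ l : X →ₗ[R] E, (∀ s ∈ S, l s = 0) ∧ l x ≠ 0 := by
  obtain ⟨l, hl⟩ := exists_functional_ne_zero hj (x := S.mkQ x) (by simpa using hx)
  exact ⟨l ∘ₗ S.mkQ, fun s hs ↦ by simp [(Submodule.Quotient.mk_eq_zero S).mpr hs], hl⟩

omit [Module.Injective R E] in
lemma exists_eq_smul_of_isEssentialMap (hess : IsEssentialMap j)
    (ψ : (R ⧸ maximalIdeal R) →ₗ[R] E) : ∃ c : R, ψ = c • j := by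
  by_cases hψ : ψ = 0
  · exact ⟨0, by simp [hψ]⟩
  have hr : ¬ Disjoint (LinearMap.range ψ) (LinearMap.range j) := fun h ↦
    hψ (LinearMap.range_eq_bot.mp (hess _ h))
  rw [Submodule.disjoint_def] at hr
  push Not at hr
  obtain ⟨x, ⟨a, ha⟩, ⟨b, hb⟩, hx⟩ := hr
  obtain ⟨a, rfl⟩ := Submodule.mkQ_surjective _ a
  obtain ⟨b, rfl⟩ := Submodule.mkQ_surjective _ b
  have hau : IsUnit a := by
    by_contra hn
    have : (maximalIdeal R).mkQ a = 0 :=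
      (Submodule.Quotient.mk_eq_zero _).mpr ((mem_maximalIdeal a).mpr hn)
    exact hx (by rw [← ha, this, map_zero])
  obtain ⟨u, rfl⟩ := hau
  have key : ∀ (χ : (R ⧸ maximalIdeal R) →ₗ[R] E) (r : R),
      χ ((maximalIdeal R).mkQ r) = r • χ ((maximalIdeal R).mkQ 1) := fun χ r ↦ by
    rw [← map_smul, ← map_smul, smul_eq_mul, mul_one]
  refine ⟨(↑u⁻¹ : R) * b, ?_⟩
  apply Submodule.linearMap_qext
  ext
  have h1 : (u : R) • ψ ((maximalIdeal R).mkQ 1) = b • j ((maximalIdeal R).mkQ 1) := by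
    rw [← key, ← key, ha, hb]
  calc ψ ((maximalIdeal R).mkQ 1)
      = (↑u⁻¹ : R) • (u : R) • ψ ((maximalIdeal R).mkQ 1) := by simp [smul_smul]
    _ = _ := by rw [h1, smul_smul]; rfl

omit [Module.Injective R E] in
/-- The Matlis dual of the residue field is the residue field. -/
lemma nonempty_residueField_dual_equiv (hj : Function.Injective j) (hess : IsEssentialMap j) :
    Nonempty ((R ⧸ maximalIdeal R) ≃ₗ[R] ((R ⧸ maximalIdeal R) →ₗ[R] E)) := by
  let τ := LinearMap.toSpanSingleton R _ j
  have hs : Function.Surjective τ := fun ψ ↦ by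
    obtain ⟨c, rfl⟩ := exists_eq_smul_of_isEssentialMap hess ψ
    exact ⟨c, rfl⟩
  have hk : LinearMap.ker τ = maximalIdeal R := by
    ext c
    rw [LinearMap.mem_ker, LinearMap.toSpanSingleton_apply]
    refine ⟨fun h ↦ ?_, fun h ↦ ?_⟩
    · have h1 := LinearMap.congr_fun h ((maximalIdeal R).mkQ 1)
      rw [LinearMap.smul_apply, ← map_smul, ← map_smul, LinearMap.zero_apply] at h1
      have h2 := hj (h1.trans (map_zero j).symm)
      simpa using (Submodule.Quotient.mk_eq_zero _).mp h2
    · apply Submodule.linearMap_qext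
      ext
      change c • j ((maximalIdeal R).mkQ 1) = 0
      rw [← map_smul, ← map_smul]
      simpa using! congrArg j ((Submodule.Quotient.mk_eq_zero (maximalIdeal R)).mpr h)
  exact ⟨(Submodule.quotEquivOfEq _ _ hk.symm).trans (τ.quotKerEquivOfSurjective hs)⟩

omit [Module.Injective R E] in
/-- The residue field is Matlis reflexive: every functional on its dual is an evaluation. -/
lemma exists_eval_of_residueField (hess : IsEssentialMap j)
    (Λ : ((R ⧸ maximalIdeal R) →ₗ[R] E) →ₗ[R] E) : ∃ a, ∀ ψ, Λ ψ = ψ a := by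
  have hle : maximalIdeal R ≤ LinearMap.ker (LinearMap.toSpanSingleton R E (Λ j)) := by
    intro c hc
    rw [LinearMap.mem_ker, LinearMap.toSpanSingleton_apply, ← map_smul]
    have : c • j = 0 := by
      apply Submodule.linearMap_qext
      ext
      change c • j ((maximalIdeal R).mkQ 1) = 0
      rw [← map_smul, ← map_smul]
      simpa using! congrArg j ((Submodule.Quotient.mk_eq_zero (maximalIdeal R)).mpr hc)
    rw [this, map_zero]
  obtain ⟨c, hc⟩ := exists_eq_smul_of_isEssentialMap hess
    ((maximalIdeal R).liftQ (LinearMap.toSpanSingleton R E (Λ j)) hle)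
  have hΛ : Λ j = c • j ((maximalIdeal R).mkQ 1) := by
    have := LinearMap.congr_fun hc ((maximalIdeal R).mkQ 1)
    rwa [Submodule.mkQ_apply, Submodule.liftQ_apply, LinearMap.toSpanSingleton_apply,
      one_smul] at this
  refine ⟨c • (maximalIdeal R).mkQ 1, fun ψ ↦ ?_⟩
  obtain ⟨b, rfl⟩ := exists_eq_smul_of_isEssentialMap hess ψ
  rw [map_smul, hΛ, map_smul, LinearMap.smul_apply, smul_comm]

/-- Matlis duality for modules of finite length: the dual is finitely generated, and every
functional on it is an evaluation. The dual is filtered by copies of the residue field; of this only the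
vanishing of `Ext` that it entails is recorded. -/
theorem matlisDual_of_isFiniteLength [IsNoetherianRing R] (hj : Function.Injective j)
    (hess : IsEssentialMap j) {M : Type u} [AddCommGroup M] [Module R M]
    (hM : IsFiniteLength R M) :
    Module.Finite R (M →ₗ[R] E) ∧
    (∀ Λ : (M →ₗ[R] E) →ₗ[R] E, ∃ m, ∀ ψ, Λ ψ = ψ m) ∧
    ∀ (B : Type u) [AddCommGroup B] [Module R B] (i : ℕ),
      ExtVanishes R (R ⧸ maximalIdeal R) B i → ExtVanishes R (M →ₗ[R] E) B i := by
  induction hM with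
  | of_subsingleton =>
    refine ⟨inferInstance, fun Λ ↦ ⟨0, fun ψ ↦ ?_⟩, fun B _ _ i _ ↦ extVanishes_of_subsingleton i⟩
    rw [Subsingleton.elim ψ 0]; simp
  | @of_simple_quotient M _ _ N _ _ ih =>
    obtain ⟨ih1, ih2, ih3⟩ := ih
    have hs : ShortExactMaps N.subtype N.mkQ :=
      ⟨N.injective_subtype, LinearMap.exact_subtype_mkQ N, N.mkQ_surjective⟩
    have hd := hs.lcomp_of_injective (E := E)
    obtain ⟨I, hI, ⟨e⟩⟩ := isSimpleModule_iff_quot_maximal.mp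
      (inferInstance : IsSimpleModule R (M ⧸ N))
    obtain rfl := IsLocalRing.eq_maximalIdeal hI
    obtain ⟨e'⟩ := nonempty_residueField_dual_equiv hj hess
    let e'' : (R ⧸ maximalIdeal R) ≃ₗ[R] ((M ⧸ N) →ₗ[R] E) :=
      e'.trans (LinearEquiv.arrowCongr e.symm (LinearEquiv.refl R E))
    have : Module.Finite R ((M ⧸ N) →ₗ[R] E) := Module.Finite.equiv e''
    refine ⟨Module.Finite.of_exact hd.exact hd.surjective, fun Λ ↦ ?_, fun B _ _ i hV ↦ ?_⟩
    · obtain ⟨a, ha⟩ := exists_eval_of_residueField hess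
        (Λ ∘ₗ LinearMap.lcomp R E N.mkQ ∘ₗ LinearMap.lcomp R E e.toLinearMap)
      obtain ⟨m, hm⟩ := N.mkQ_surjective (e.symm a)
      have h0 : ∀ ψ : (M ⧸ N) →ₗ[R] E, Λ (ψ ∘ₗ N.mkQ) = ψ (N.mkQ m) := fun ψ ↦ by
        have := ha (ψ ∘ₗ e.symm.toLinearMap)
        have h1 : ψ ∘ₗ N.mkQ = ((ψ ∘ₗ e.symm.toLinearMap) ∘ₗ e.toLinearMap) ∘ₗ N.mkQ := by
          ext; simp
        rw [hm, h1]
        exact this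
      obtain ⟨Λ', hΛ'⟩ := ((hd.lcomp_of_injective (E := E)).exact
        (Λ - LinearMap.applyₗ m)).mp (LinearMap.ext fun ψ ↦ sub_eq_zero.mpr (h0 ψ))
      obtain ⟨n, hn⟩ := ih2 Λ'
      refine ⟨m + n, fun ψ ↦ ?_⟩
      have h1 := LinearMap.congr_fun hΛ' ψ
      have h2 := hn (ψ ∘ₗ N.subtype)
      simp only [LinearMap.lcomp_apply', LinearMap.sub_apply, LinearMap.applyₗ_apply_apply] at h1
      rw [map_add, ← sub_eq_iff_eq_add', ← h1]
      exact h2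
    · exact hd.extVanishes_mid (hV.congr_left e'') (ih3 B i hV)

/-- A module of finite length is isomorphic to its Matlis bidual. -/
lemma nonempty_matlisBidual_equiv [IsNoetherianRing R] (hj : Function.Injective j)
    (hess : IsEssentialMap j) {M : Type u} [AddCommGroup M] [Module R M]
    (hM : IsFiniteLength R M) : Nonempty (M ≃ₗ[R] ((M →ₗ[R] E) →ₗ[R] E)) := by
  refine ⟨LinearEquiv.ofBijective (LinearMap.id.flip) ⟨?_, fun Λ ↦ ?_⟩⟩
  · rw [injective_iff_map_eq_zero]
    intro m hm
    by_contra h0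
    obtain ⟨l, hl⟩ := exists_functional_ne_zero hj h0
    exact hl (LinearMap.congr_fun hm l)
  · obtain ⟨m, hm⟩ := (matlisDual_of_isFiniteLength hj hess hM).2.1 Λ
    exact ⟨m, by ext ψ; exact (hm ψ).symm⟩

end MatlisDuality

/-! ### Injective dimension and depth of a Gorenstein local ring -/

section Bass

variable {R : Type u} [CommRing R]

open IsLocalRing

lemma module_injective_of_extVanishes_quotient {B : Type u} [AddCommGroup B] [Module R B]
    (h : ∀ I : Ideal R, ExtVanishes R (R ⧸ I) B 1) : Module.Injective R B := by
  refine Module.Baer.injective fun I g ↦ ?_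
  have hs : ShortExactMaps I.subtype I.mkQ :=
    ⟨I.injective_subtype, LinearMap.exact_subtype_mkQ I, I.mkQ_surjective⟩
  obtain ⟨ψ, hψ⟩ := hs.exists_extension (h I) g
  exact ⟨ψ, fun x hx ↦ LinearMap.congr_fun hψ ⟨x, hx⟩⟩

/-- Baer's criterion in higher degrees. -/
lemma extVanishes_of_forall_quotient {B : Type u} [AddCommGroup B] [Module R B] (i : ℕ)
    (h : ∀ I : Ideal R, ExtVanishes R (R ⧸ I) B (i + 1)) (X : Type u) [AddCommGroup X]
    [Module R X] : ExtVanishes R X B (i + 1) := by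
  induction i generalizing B with
  | zero =>
    have := module_injective_of_extVanishes_quotient h
    exact extVanishes_of_injective 0
  | succ i ih =>
    obtain ⟨I, f, hf, _⟩ := exists_injective_embedding R B
    have hs := shortExactMaps_mkQ hf
    exact hs.extVanishes_left' (ih fun J ↦
      hs.extVanishes_right' (extVanishes_of_injective i) (h J)) (extVanishes_of_injective _)

lemma extVanishes_of_forall_quotient_prime [IsNoetherianRing R] {B : Type u} [AddCommGroup B]
    [Module R B] (i : ℕ) (h : ∀ p : Ideal R, p.IsPrime → ExtVanishes R (R ⧸ p) B i) {X : Type u}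
    [AddCommGroup X] [Module R X] (hX : Module.Finite R X) : ExtVanishes R X B i := by
  induction hX using IsNoetherianRing.induction_on_isQuotientEquivQuotientPrime R with
  | subsingleton N => exact extVanishes_of_subsingleton i
  | quotient N p e => exact (h p.1 p.2).congr_left e.symm
  | exact N₁ N₂ N₃ f g hf hg hfg h₁ h₃ =>
    exact ShortExactMaps.extVanishes_mid ⟨hf, hfg, hg⟩ h₁ h₃

/-- If `x` acts injectively on `X` and `Ext^{i+1}(X / xX, B) = 0`, then Nakayama's lemma gives
`Ext^i(X, B) = 0`. -/
lemma extVanishes_of_quotSMulTop [IsNoetherianRing R] [IsLocalRing R] {X B : Type u}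
    [AddCommGroup X] [Module R X] [Module.Finite R X] [AddCommGroup B] [Module R B]
    [Module.Finite R B] {x : R} (hx : x ∈ maximalIdeal R) (hreg : IsSMulRegular X x) {i : ℕ}
    (h : ExtVanishes R (QuotSMulTop x X) B (i + 1)) : ExtVanishes R X B i := by
  have hS := hreg.smulShortComplex_shortExact (M := ModuleCat.of R X)
  have hle : (⊤ : Submodule R (Abelian.Ext (ModuleCat.of R X) (ModuleCat.of R B) i)) ≤
      maximalIdeal R • ⊤ := by
    intro y _
    obtain ⟨z, rfl⟩ := Abelian.Ext.contravariant_sequence_exact₁ hS (ModuleCat.of R B) y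
      (add_comm 1 i) (h.elim _ _)
    have key : ∀ z : Abelian.Ext (ModuleCat.of R X) (ModuleCat.of R B) i,
        (Abelian.Ext.mk₀ (x • 𝟙 (ModuleCat.of R X))).comp z (zero_add i) = x • z := fun z ↦ by
      rw [Abelian.Ext.mk₀_smul, Abelian.Ext.smul_comp, Abelian.Ext.mk₀_id_comp]
    exact (congrArg (· ∈ maximalIdeal R • (⊤ : Submodule R
      (Abelian.Ext (ModuleCat.of R X) (ModuleCat.of R B) i))) (key z)).mpr
      (Submodule.smul_mem_smul hx trivial)
  have hfg : (⊤ : Submodule R (Abelian.Ext (ModuleCat.of R X) (ModuleCat.of R B) i)).FG :=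
    Module.Finite.fg_top
  have := Submodule.eq_bot_of_le_smul_of_le_jacobson_bot _ _ hfg hle (maximalIdeal_le_jacobson _)
  exact (Submodule.subsingleton_iff R).mp (subsingleton_of_bot_eq_top this.symm)

/-- Bass's lemma at the top degree: if `Ext^i(-, B)` vanishes for `i > r`, then its vanishing in
degree `r` is detected by the residue field. -/
lemma extVanishes_of_residueField [IsNoetherianRing R] [IsLocalRing R] {B : Type u}
    [AddCommGroup B] [Module R B] [Module.Finite R B] {r : ℕ}
    (hr : ∀ (X : Type u) [AddCommGroup X] [Module R X], ExtVanishes R X B (r + 1))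
    (hk : ExtVanishes R (R ⧸ maximalIdeal R) B r) {X : Type u} [AddCommGroup X] [Module R X]
    (hX : Module.Finite R X) : ExtVanishes R X B r := by
  refine extVanishes_of_forall_quotient_prime r (fun p hp ↦ ?_) hX
  by_cases hpm : p = maximalIdeal R
  · rwa [hpm]
  · obtain ⟨y, hy, hyp⟩ := SetLike.exists_of_lt (lt_of_le_of_ne (le_maximalIdeal hp.ne_top) hpm)
    refine extVanishes_of_quotSMulTop hy (fun a b hab ↦ ?_) (hr _)
    obtain ⟨a, rfl⟩ := Ideal.Quotient.mk_surjective a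
    obtain ⟨b, rfl⟩ := Ideal.Quotient.mk_surjective b
    have h1 : Ideal.Quotient.mk p (y * a) = Ideal.Quotient.mk p (y * b) := hab
    rw [Ideal.Quotient.eq, ← mul_sub] at h1
    exact Ideal.Quotient.eq.mpr ((hp.mem_or_mem h1).resolve_left hyp)

/-- A Gorenstein local ring has the same injective dimension `r` as depth, and `r` is at most the
Krull dimension. The depth enters through the vanishing of `Ext^j(k, R)` for `j < r`. -/
theorem exists_injectiveDimension_eq_depth [IsGorensteinLocalRing R] (d : ℕ)
    (hd : ringKrullDim R = d) : ∃ r ≤ d,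
      (∀ (X : Type u) [AddCommGroup X] [Module R X] (i : ℕ), r < i → ExtVanishes R X R i) ∧
      (∀ j < r, ExtVanishes R (R ⧸ maximalIdeal R) R j) ∧
      ¬ ExtVanishes R (R ⧸ maximalIdeal R) R r := by
  classical
  have hex : ∃ r : ℕ, ∀ (X : Type u) [AddCommGroup X] [Module R X] (i : ℕ), r < i →
      ExtVanishes R X R i := by
    obtain ⟨n, hn⟩ := (injectiveDimension_ne_top_iff (ModuleCat.of R R)).mp
      IsGorensteinLocalRing.injectiveDimension_ne_top
    exact ⟨n, fun X _ _ i hi ↦ HasInjectiveDimensionLT.subsingleton _ (n + 1) i hi _⟩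
  let r := Nat.find hex
  have hr : ∀ (X : Type u) [AddCommGroup X] [Module R X] (i : ℕ), r < i → ExtVanishes R X R i :=
    Nat.find_spec hex
  have hkr : ¬ ExtVanishes R (R ⧸ maximalIdeal R) R r := by
    intro hk
    have hfin : ∀ (X : Type u) [AddCommGroup X] [Module R X], Module.Finite R X →
        ExtVanishes R X R r := fun X _ _ hX ↦
      extVanishes_of_residueField (fun X _ _ ↦ hr X _ (Nat.lt_succ_self r)) hk hX
    rcases Nat.eq_zero_or_pos r with h0 | hpos
    · have := extVanishes_zero_iff.mp (h0 ▸ hfin R inferInstance)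
      exact one_ne_zero (LinearMap.congr_fun (Subsingleton.elim (LinearMap.id : R →ₗ[R] R) 0) 1)
    · obtain ⟨s, hs⟩ := Nat.exists_eq_add_of_le' hpos
      refine Nat.find_min hex (m := s) (by omega) fun X _ _ i hi ↦ ?_
      rcases (Nat.succ_le_of_lt hi).eq_or_lt with h1 | h1
      · rw [← h1]
        refine extVanishes_of_forall_quotient s (fun I ↦ ?_) X
        have := hfin (R ⧸ I) inferInstance
        rwa [hs] at this
      · exact hr X i (by omega)
  -- `t` is the depth of `R`
  have hext : ∃ t, ¬ ExtVanishes R (R ⧸ maximalIdeal R) R t := ⟨r, hkr⟩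
  let t := Nat.find hext
  have hkt : ¬ ExtVanishes R (R ⧸ maximalIdeal R) R t := Nat.find_spec hext
  have hjt : ∀ j < t, ExtVanishes R (R ⧸ maximalIdeal R) R j := fun j hj ↦
    not_not.mp (Nat.find_min hext hj)
  have hlt : maximalIdeal R • (⊤ : Submodule R (ModuleCat.of R R)) < ⊤ := by
    have : maximalIdeal R • (⊤ : Ideal R) < ⊤ := by
      simpa using (maximalIdeal.isMaximal R).ne_top.lt_top
    exact this
  have hsupp : Module.support R (R ⧸ maximalIdeal R) =
      PrimeSpectrum.zeroLocus (maximalIdeal R) := by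
    rw [Module.support_eq_zeroLocus, Ideal.annihilator_quotient]
  obtain ⟨rs, hlen, hmem, hreg⟩ := ModuleCat.exists_isRegular_of_exists_subsingleton_ext
    (maximalIdeal R) t (ModuleCat.of R R) hlt (ModuleCat.of R (R ⧸ maximalIdeal R)) hsupp hjt
  have hreg : RingTheory.Sequence.IsRegular R rs := hreg
  have htd : t ≤ d := by
    have h1 := ringKrullDim_add_length_eq_ringKrullDim_of_isRegular rs hreg
    have : Nontrivial (R ⧸ Ideal.ofList rs) :=
      Ideal.Quotient.nontrivial_iff.mpr fun h ↦ hreg.2 (by simp [h])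
    have h2 : (t : WithBot ℕ∞) ≤ d := by
      rw [← hd, ← h1, hlen]
      exact le_add_of_nonneg_left ringKrullDim_nonneg_of_nontrivial
    exact_mod_cast h2
  -- `A` has projective dimension `t` and contains a copy of `k`, by maximality of `rs`
  let A := R ⧸ Ideal.ofList rs
  have hA : ¬ Subsingleton ((R ⧸ maximalIdeal R) →ₗ[R] A) := by
    intro h
    obtain ⟨x, hx, hxreg⟩ := IsSMulRegular.subsingleton_linearMap_iff.mp h
    rw [Ideal.annihilator_quotient] at hx
    have e : (R ⧸ (Ideal.ofList rs • (⊤ : Ideal R))) ≃ₗ[R] A :=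
      Submodule.quotEquivOfEq _ _ (by simp)
    have hw : RingTheory.Sequence.IsWeaklyRegular R (rs ++ [x]) :=
      (RingTheory.Sequence.isWeaklyRegular_append_iff R rs [x]).mpr ⟨hreg.1,
        (RingTheory.Sequence.isWeaklyRegular_singleton_iff _ x).mpr
          ((e.isSMulRegular_congr x).mpr hxreg)⟩
    have hmem' : ∀ y ∈ rs ++ [x], y ∈ maximalIdeal R := by
      rintro y hy
      rcases List.mem_append.mp hy with h1 | h1
      · exact hmem y h1
      · rwa [List.mem_singleton.mp h1]
    exact hkt (ModuleCat.subsingleton_ext_of_exists_isRegular (maximalIdeal R)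
      (ModuleCat.of R (R ⧸ maximalIdeal R)) hsupp.subset (ModuleCat.of R R) hlt (rs ++ [x]) hmem'
      ((IsLocalRing.isRegular_iff_isWeaklyRegular_of_subset_maximalIdeal hmem').mpr hw) t
      (by simp [hlen]))
  have hrt : r ≤ t := by
    by_contra! hlt
    have h1 : ExtVanishes R A R r := by
      have hpd := ModuleCat.projectiveDimension_quotient_eq_length.{u} rs hreg
      have : HasProjectiveDimensionLT (ModuleCat.of R (Shrink.{u} A)) r := by
        rw [← projectiveDimension_lt_iff, hpd, hlen]
        exact_mod_cast hlt
      exact ExtVanishes.congr_left (X := Shrink.{u} A)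
        (HasProjectiveDimensionLT.subsingleton _ r r le_rfl _) (Shrink.linearEquiv R A)
    rw [not_subsingleton_iff_nontrivial] at hA
    obtain ⟨φ, hφ⟩ := exists_ne (0 : (R ⧸ maximalIdeal R) →ₗ[R] A)
    have hφi : Function.Injective φ := by
      exact (LinearMap.injective_or_eq_zero φ).resolve_right hφ
    exact hkr ((shortExactMaps_mkQ hφi).extVanishes_left h1 (hr _ _ (Nat.lt_succ_self r)))
  have hrt' : r = t := le_antisymm hrt (Nat.find_min' _ hkr)
  exact ⟨r, hrt' ▸ htd, hr, hrt' ▸ hjt, hkr⟩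

end Bass

/-! ### Maximal Cohen–Macaulay modules and complete resolutions -/

section MaximalCohenMacaulay

variable {R : Type u} [CommRing R]

/-- Finitely generated modules `X` with `Ext^i(X, R) = 0` for all `i > 0`. Over a Gorenstein local
ring these are the maximal Cohen–Macaulay modules. -/
structure IsExtAcyclic (R : Type u) [CommRing R] (X : Type u) [AddCommGroup X] [Module R X] :
    Prop where
  finite : Module.Finite R X
  ext : ∀ i, ExtVanishes R X R (i + 1)

/-- `Ext^i(X, Y) = 0` for all `i ≫ 0`. -/
def ExtEventuallyVanishes (R : Type u) [CommRing R] (X Y : Type u) [AddCommGroup X] [Module R X]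
    [AddCommGroup Y] [Module R Y] : Prop :=
  ∃ n, ∀ i, n < i → ExtVanishes R X Y i

variable {A B C P X Y W : Type u} [AddCommGroup A] [Module R A] [AddCommGroup B] [Module R B]
  [AddCommGroup C] [Module R C] [AddCommGroup P] [Module R P] [AddCommGroup X] [Module R X]
  [AddCommGroup Y] [Module R Y] [AddCommGroup W] [Module R W]

lemma ShortExactMaps.extEventuallyVanishes_right {f : A →ₗ[R] B} {g : B →ₗ[R] C}
    (h : ShortExactMaps f g) (hA : ExtEventuallyVanishes R A Y)
    (hB : ExtEventuallyVanishes R B Y) : ExtEventuallyVanishes R C Y := by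
  obtain ⟨n, hn⟩ := hA
  obtain ⟨m, hm⟩ := hB
  refine ⟨n + m + 1, fun i hi ↦ ?_⟩
  obtain ⟨i, rfl⟩ := Nat.exists_eq_add_of_le' (show 1 ≤ i by omega)
  exact h.extVanishes_right (hn i (by omega)) (hm _ (by omega))

lemma ShortExactMaps.extEventuallyVanishes_left {f : A →ₗ[R] B} {g : B →ₗ[R] C}
    (h : ShortExactMaps f g) (hB : ExtEventuallyVanishes R B Y)
    (hC : ExtEventuallyVanishes R C Y) : ExtEventuallyVanishes R A Y := by
  obtain ⟨n, hn⟩ := hB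
  obtain ⟨m, hm⟩ := hC
  exact ⟨n + m, fun i hi ↦ h.extVanishes_left (hn i (by omega)) (hm _ (by omega))⟩

lemma extEventuallyVanishes_of_projective [Module.Projective R X] :
    ExtEventuallyVanishes R X Y := by
  refine ⟨0, fun i hi ↦ ?_⟩
  obtain ⟨i, rfl⟩ := Nat.exists_eq_add_of_le' hi
  exact extVanishes_of_projective i

lemma IsExtAcyclic.syzygy [IsNoetherianRing R] [Module.Finite R P] [Module.Projective R P]
    {f : A →ₗ[R] P} {g : P →ₗ[R] X} (h : ShortExactMaps f g) (hX : IsExtAcyclic R X) :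
    IsExtAcyclic R A :=
  ⟨Module.Finite.of_injective f h.injective,
    fun i ↦ h.extVanishes_left (extVanishes_of_projective i) (hX.ext (i + 1))⟩

lemma IsExtAcyclic.dual_shortExact {f : A →ₗ[R] B} {g : B →ₗ[R] X} (h : ShortExactMaps f g)
    (hX : IsExtAcyclic R X) :
    ShortExactMaps (LinearMap.lcomp R R g) (LinearMap.lcomp R R f) :=
  h.lcomp (h.exists_extension (hX.ext 0))

section Gorenstein

variable [IsNoetherianRing R] {r : ℕ}
  (hr : ∀ (X : Type u) [AddCommGroup X] [Module R X] (i : ℕ), r < i → ExtVanishes R X R i)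

include hr

lemma IsExtAcyclic.dual (hX : IsExtAcyclic R X) : IsExtAcyclic R (Module.Dual R X) := by
  have := hX.finite
  refine ⟨inferInstance, fun i ↦ ?_⟩
  -- `X^*` is an arbitrarily high syzygy of the dual of a syzygy of `X`
  have key : ∀ (k : ℕ) {X : Type u} [AddCommGroup X] [Module R X], IsExtAcyclic R X →
      ∀ i, r < i + 1 + k → ExtVanishes R (Module.Dual R X) R (i + 1) := by
    intro k
    induction k with
    | zero => exact fun _ i hi ↦ hr _ _ hi
    | succ k ih =>
      intro X _ _ hX i hi
      have := hX.finite
      obtain ⟨n, π, hπ⟩ := Module.Finite.exists_fin' R X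
      have h := shortExactMaps_ker hπ
      exact (hX.dual_shortExact h).extVanishes_left (extVanishes_of_projective i)
        (ih (hX.syzygy h) (i + 1) (by omega))
  exact key r hX i (by omega)

lemma IsExtAcyclic.eval_surjective (hX : IsExtAcyclic R X) :
    Function.Surjective (Module.Dual.eval R X) := by
  have := hX.finite
  obtain ⟨n, π, hπ⟩ := Module.Finite.exists_fin' R X
  have h := shortExactMaps_ker hπ
  intro l
  obtain ⟨l', hl'⟩ := (hX.dual_shortExact h).exists_extension
    (((hX.syzygy h).dual hr).ext 0) l
  obtain ⟨q, rfl⟩ := (Module.bijective_dual_eval R (Fin n → R)).2 l'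
  exact ⟨π q, hl'⟩

/-- Over a Gorenstein ring the modules `X` with `Ext^i(X, R) = 0` for `i > 0` are reflexive. -/
lemma IsExtAcyclic.eval_bijective (hX : IsExtAcyclic R X) :
    Function.Bijective (Module.Dual.eval R X) := by
  refine ⟨?_, hX.eval_surjective hr⟩
  have := hX.finite
  obtain ⟨n, π, hπ⟩ := Module.Finite.exists_fin' R X
  have h := shortExactMaps_ker hπ
  rw [injective_iff_map_eq_zero]
  intro x hx
  obtain ⟨q, rfl⟩ := hπ x
  -- evaluation at `q` kills the functionals that factor through `π`
  obtain ⟨l, hl⟩ := (hX.dual_shortExact h).exists_factor (Module.Dual.eval R _ q)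
    (LinearMap.ext fun φ ↦ LinearMap.congr_fun hx φ)
  obtain ⟨z, rfl⟩ := (hX.syzygy h).eval_surjective hr l
  have hqz : q = z := (Module.bijective_dual_eval R (Fin n → R)).1 hl.symm
  rw [hqz]
  exact z.2

/-- Dualizing a presentation `0 → Z → Q → X^* → 0` gives a coresolution `0 → X → Q^* → Z^* → 0`. -/
lemma IsExtAcyclic.coresolution (hX : IsExtAcyclic R X) {f : A →ₗ[R] P}
    {g : P →ₗ[R] Module.Dual R X} (h : ShortExactMaps f g) :
    ShortExactMaps (LinearMap.lcomp R R g ∘ₗ Module.Dual.eval R X) (LinearMap.lcomp R R f) := by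
  have hd := (hX.dual hr).dual_shortExact h
  have he := hX.eval_bijective hr
  refine ⟨hd.injective.comp he.1, fun y ↦ (hd.exact y).trans ?_, hd.surjective⟩
  constructor
  · rintro ⟨l, rfl⟩
    obtain ⟨x, rfl⟩ := he.2 l
    exact ⟨x, rfl⟩
  · rintro ⟨x, rfl⟩
    exact ⟨_, rfl⟩

omit hr [IsNoetherianRing R] in
lemma extVanishes_of_xiInvariant_lt (hX : Module.Finite R X)
    (hV : ExtEventuallyVanishes R X W) {i : ℕ} (hi : xiInvariant R < i) : ExtVanishes R X W i := by
  obtain ⟨n, hn⟩ := hV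
  have h1 : extSup R X W ≤ n := by
    refine iSup₂_le fun i hi ↦ ?_
    by_contra! hlt
    exact not_subsingleton_iff_nontrivial.mpr hi (hn i (by exact_mod_cast hlt))
  have h2 : extSup R X W ≤ xiInvariant R :=
    le_iSup_of_le (ModuleCat.of R X) <| le_iSup_of_le (ModuleCat.of R W) <|
      le_iSup_of_le hX <| le_iSup_of_le (h1.trans_lt (ENat.natCast_lt_top n)) le_rfl
  by_contra hne
  have h3 : (i : ℕ∞) ≤ extSup R X W :=
    le_iSup₂_of_le i (not_subsingleton_iff_nontrivial.mp hne) le_rfl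
  exact absurd (h3.trans h2) (not_le.mpr hi)

/-- Passing to cosyzygies of `X` shifts the degrees of `Ext(X, W)` up, so a uniform bound `ξ(R)` on
the degrees forces all of the positive ones to vanish. -/
lemma IsExtAcyclic.extVanishes_of_xiInvariant (hxi : xiInvariant R < ⊤) (hX : IsExtAcyclic R X)
    (hV : ExtEventuallyVanishes R X W) (i : ℕ) : ExtVanishes R X W (i + 1) := by
  obtain ⟨c, hc⟩ := ENat.ne_top_iff_exists.mp hxi.ne
  have key : ∀ (m : ℕ) {X : Type u} [AddCommGroup X] [Module R X], IsExtAcyclic R X →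
      ExtEventuallyVanishes R X W → ∀ i, c < i + 1 + m → ExtVanishes R X W (i + 1) := by
    intro m
    induction m with
    | zero =>
      intro X _ _ hX hV i hi
      exact extVanishes_of_xiInvariant_lt hX.finite hV (by rw [← hc]; exact_mod_cast hi)
    | succ m ih =>
      intro X _ _ hX hV i hi
      have := (hX.dual hr).finite
      obtain ⟨n, π, hπ⟩ := Module.Finite.exists_fin' R (Module.Dual R X)
      have h := shortExactMaps_ker hπ
      have h' := hX.coresolution hr h
      exact h'.extVanishes_left (extVanishes_of_projective i)
        (ih (((hX.dual hr).syzygy h).dual hr)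
          (h'.extEventuallyVanishes_right hV extEventuallyVanishes_of_projective)
          (i + 1) (by omega))
  exact key c hX hV i (by omega)

end Gorenstein

/-- For a finite free module `Q`, a functional on `Hom(Q, N) = Q^* ⊗ N` is determined by its values
on elementary tensors. If on these it is pulled back along the transpose of `p`, then it
vanishes on the homomorphisms killed by `p`. -/
lemma functional_eq_zero_of_comp_eq_zero {N E : Type u} [AddCommGroup N] [Module R N]
    [AddCommGroup E] [Module R E] {a b : ℕ} (p : (Fin b → R) →ₗ[R] (Fin a → R))
    (l : ((Fin a → R) →ₗ[R] N) →ₗ[R] E) (ν : Module.Dual R (Fin b → R) →ₗ[R] (N →ₗ[R] E))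
    (hν : ∀ (q : Module.Dual R (Fin a → R)) (n : N), l (q.smulRight n) = ν (q ∘ₗ p) n)
    (h : (Fin a → R) →ₗ[R] N) (hp : h ∘ₗ p = 0) : l h = 0 := by
  have h1 : h = ∑ i, (LinearMap.proj i : (Fin a → R) →ₗ[R] R).smulRight (h (Pi.single i 1)) := by
    refine LinearMap.pi_ext' fun i ↦ ?_
    ext
    simp [Finset.sum_apply, Pi.single_apply]
  have h2 : ∀ i, (LinearMap.proj i : (Fin a → R) →ₗ[R] R) ∘ₗ p =
      ∑ j, p (Pi.single j 1) i • (LinearMap.proj j : (Fin b → R) →ₗ[R] R) := fun i ↦ by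
    refine LinearMap.pi_ext' fun j ↦ ?_
    ext
    simp [Finset.sum_apply, Pi.single_apply]
  have h3 : ∀ j, ∑ i, p (Pi.single j 1) i • h (Pi.single i 1) = 0 := fun j ↦ by
    have := LinearMap.congr_fun hp (Pi.single j 1)
    rw [LinearMap.comp_apply, h1] at this
    simpa using this
  rw [h1, map_sum]
  simp only [hν, h2, map_sum, map_smul, LinearMap.sum_apply, LinearMap.smul_apply]
  rw [Finset.sum_comm]
  refine Finset.sum_eq_zero fun j _ ↦ ?_
  simpa only [map_sum, map_smul, map_zero] using congrArg (ν (LinearMap.proj j)) (h3 j)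

section Transpose

open IsLocalRing

variable [IsNoetherianRing R] [IsLocalRing R] {r : ℕ}
  (hr : ∀ (X : Type u) [AddCommGroup X] [Module R X] (i : ℕ), r < i → ExtVanishes R X R i)
  (hxi : xiInvariant R < ⊤)
  {E : Type u} [AddCommGroup E] [Module R E] [Module.Injective R E]
  {j : (R ⧸ maximalIdeal R) →ₗ[R] E} (hj : Function.Injective j)
  {N : Type u} [AddCommGroup N] [Module R N]

include hr hxi hj

lemma IsExtAcyclic.extVanishes_dual_one (hX : IsExtAcyclic R X)
    (hV : ExtEventuallyVanishes R X (N →ₗ[R] E)) : ExtVanishes R (Module.Dual R X) N 1 := by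
  have hX' := hX.dual hr
  have := hX'.finite
  obtain ⟨n₀, π₀, hπ₀⟩ := Module.Finite.exists_fin' R (Module.Dual R X)
  have s₀ := shortExactMaps_ker hπ₀
  have hZ₀ := hX'.syzygy s₀
  have := hZ₀.finite
  obtain ⟨n₁, π₁, hπ₁⟩ := Module.Finite.exists_fin' R (LinearMap.ker π₀)
  have s₁ := shortExactMaps_ker hπ₁
  have hZ₁ := hZ₀.syzygy s₁
  have := hZ₁.finite
  obtain ⟨n₂, π₂, hπ₂⟩ := Module.Finite.exists_fin' R (LinearMap.ker π₁)
  have s₂ := shortExactMaps_ker hπ₂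
  have hZ₂ := hZ₁.syzygy s₂
  have d₀ := hX.coresolution hr s₀
  have d₁ := hZ₀.dual_shortExact s₁
  have d₂ := hZ₁.dual_shortExact s₂
  have hV₂ : ExtVanishes R (Module.Dual R (LinearMap.ker π₂)) (N →ₗ[R] E) 1 :=
    (hZ₂.dual hr).extVanishes_of_xiInvariant hr hxi
      (d₂.extEventuallyVanishes_right (d₁.extEventuallyVanishes_right
        (d₀.extEventuallyVanishes_right hV extEventuallyVanishes_of_projective)
        extEventuallyVanishes_of_projective) extEventuallyVanishes_of_projective) 0
  refine s₀.extVanishes_one_of_extension (extVanishes_of_projective 0) fun φ ↦ ?_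
  by_contra hφ
  -- a functional `l` on `Hom(Z₀, N)` that separates `φ` from the maps extending to `Q₀`
  obtain ⟨l, hl, hlφ⟩ := exists_functional_separating hj
    (LinearMap.range (LinearMap.lcomp R N (LinearMap.ker π₀).subtype)) (x := φ) hφ
  obtain ⟨l', hl'⟩ := Module.Injective.out (LinearMap.lcomp R N π₁)
    (fun α β hαβ ↦ by
      ext z
      obtain ⟨q, rfl⟩ := hπ₁ z
      exact LinearMap.congr_fun hαβ q) l
  let μ : Module.Dual R (Fin n₁ → R) →ₗ[R] (N →ₗ[R] E) :=
    LinearMap.mk₂ R (fun q n ↦ l' (q.smulRight n))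
      (fun q q' n ↦ by rw [← map_add]; congr 1; ext; simp [add_smul])
      (fun c q n ↦ by rw [← map_smul]; congr 1; ext; simp [mul_smul])
      (fun q n n' ↦ by rw [← map_add]; congr 1; ext; simp)
      (fun c q n ↦ by rw [← map_smul]; congr 1; ext; simp [smul_comm c])
  have hμ : μ ∘ₗ LinearMap.lcomp R R π₁ = 0 := by
    ext q n
    obtain ⟨q, rfl⟩ := d₀.surjective q
    have h1 := hl' ((q.smulRight n) ∘ₗ (LinearMap.ker π₀).subtype)
    exact h1.trans (hl _ ⟨q.smulRight n, rfl⟩)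
  obtain ⟨μ', hμ'⟩ := d₁.exists_factor μ hμ
  obtain ⟨ν, hν⟩ := d₂.exists_extension hV₂ μ'
  refine hlφ ?_
  rw [← hl' φ]
  refine functional_eq_zero_of_comp_eq_zero ((LinearMap.ker π₁).subtype ∘ₗ π₂) l' ν
    (fun q n ↦ ?_) _ ?_
  · have h1 := LinearMap.congr_fun hμ' q
    rw [← hν] at h1
    exact (LinearMap.congr_fun h1 n).symm
  · ext
    simp

/-- If `Ext^i(X, Hom(N, E))` vanishes for `i ≫ 0`, then `Ext^i(X^*, N)` vanishes for `i > 0`: the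
complete resolution of `X` stays exact under `Hom(-, Hom(N, E))`, so its tensor product with `N` is
exact, and this is `Hom(-, N)` of the complete resolution of `X^*`. -/
theorem IsExtAcyclic.extVanishes_dual (hX : IsExtAcyclic R X)
    (hV : ExtEventuallyVanishes R X (N →ₗ[R] E)) (i : ℕ) :
    ExtVanishes R (Module.Dual R X) N (i + 1) := by
  induction i generalizing X with
  | zero => exact hX.extVanishes_dual_one hr hxi hj hV
  | succ i ih =>
    have hX' := hX.dual hr
    have := hX'.finite
    obtain ⟨n, π, hπ⟩ := Module.Finite.exists_fin' R (Module.Dual R X)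
    have s := shortExactMaps_ker hπ
    have hZ := hX'.syzygy s
    have h1 := ih (hZ.dual hr) ((hX.coresolution hr s).extEventuallyVanishes_right hV
      extEventuallyVanishes_of_projective)
    exact s.extVanishes_right
      (h1.congr_left (LinearEquiv.ofBijective _ (hZ.eval_bijective hr)).symm)
      (extVanishes_of_projective _)

end Transpose

end MaximalCohenMacaulay

/-! ### The module `Ext^r(L, R)` for `L` of finite length -/

section Cosyzygy

open IsLocalRing

variable {R : Type u} [CommRing R] [IsLocalRing R]

lemma IsEssentialMap.extVanishes_zero {B I : Type u} [AddCommGroup B] [Module R B]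
    [AddCommGroup I] [Module R I] {f : B →ₗ[R] I} (hess : IsEssentialMap f)
    (hf : Function.Injective f) (hB : ExtVanishes R (R ⧸ maximalIdeal R) B 0) :
    ExtVanishes R (R ⧸ maximalIdeal R) I 0 := by
  rw [extVanishes_zero_iff] at hB ⊢
  refine subsingleton_of_forall_eq 0 fun φ ↦ ?_
  by_contra hφ
  have hr : ¬ Disjoint (LinearMap.range φ) (LinearMap.range f) := fun h ↦
    hφ (LinearMap.range_eq_bot.mp (hess _ h))
  rw [Submodule.disjoint_def] at hr
  push Not at hr
  obtain ⟨x, ⟨a, rfl⟩, ⟨b, hb⟩, hx⟩ := hr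
  -- the residue field is generated by `a`, so `φ` takes values in the range of `f`
  have hmem : ∀ y, φ y ∈ LinearMap.range f := fun y ↦ by
    obtain ⟨c, rfl⟩ := IsSimpleModule.toSpanSingleton_surjective R
      (m := a) (fun h ↦ hx (by rw [h, map_zero])) y
    exact ⟨c • b, by simp [hb]⟩
  have h0 := LinearMap.congr_fun (Subsingleton.elim
    ((LinearEquiv.ofInjective f hf).symm.toLinearMap ∘ₗ φ.codRestrict _ hmem) 0) a
  rw [LinearMap.comp_apply, LinearMap.zero_apply, LinearEquiv.coe_coe,
    LinearEquiv.map_eq_zero_iff] at h0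
  exact hx (congrArg Subtype.val h0)

/-- If `Ext^j(k, B) = 0` for `j < n`, then the `n`-th cosyzygy `C` of `B` in a minimal injective
resolution satisfies `Ext^n(L, B) = Hom(L, C)` for all modules `L` that are filtered by copies of
`k`, because the injective modules in degrees below `n` have no socle. -/
theorem exists_cosyzygy (n : ℕ) (B : Type u) [AddCommGroup B] [Module R B]
    (hB : ∀ j < n, ExtVanishes R (R ⧸ maximalIdeal R) B j) : ∃ C : ModuleCat.{u} R,
      (ExtVanishes R (R ⧸ maximalIdeal R) C 0 → ExtVanishes R (R ⧸ maximalIdeal R) B n) ∧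
      (∀ (X : Type u) [AddCommGroup X] [Module R X],
        ExtVanishes R X B (n + 1) → ExtVanishes R X C 1) ∧
      ∀ (L : Type u) [AddCommGroup L] [Module R L],
        (∀ (I : Type u) [AddCommGroup I] [Module R I],
          ExtVanishes R (R ⧸ maximalIdeal R) I 0 → ExtVanishes R L I 0) →
        Nonempty (Abelian.Ext (ModuleCat.of R L) (ModuleCat.of R B) n ≃ₗ[R] (L →ₗ[R] C)) := by
  induction n generalizing B with
  | zero => exact ⟨ModuleCat.of R B, id, fun X _ _ h ↦ h, fun L _ _ _ ↦ ⟨extZeroEquiv R L B⟩⟩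
  | succ n ih =>
    obtain ⟨I, f, hf, _, hess⟩ := exists_injective_hull R B
    have hs := shortExactMaps_mkQ hf
    have hI := hess.extVanishes_zero hf (hB 0 n.succ_pos)
    have hI' : ∀ (X : Type u) [AddCommGroup X] [Module R X], ExtVanishes R X I 0 →
        ∀ i, ExtVanishes R X I i := fun X _ _ h0 i ↦ by
      cases i with
      | zero => exact h0
      | succ i => exact extVanishes_of_injective i
    obtain ⟨C, h1, h2, h3⟩ := ih (I ⧸ LinearMap.range f) fun j hj ↦
      hs.extVanishes_right' (hI' _ hI j) (hB (j + 1) (by omega))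
    refine ⟨C, fun h ↦ hs.extVanishes_left' (h1 h) (extVanishes_of_injective n),
      fun X _ _ h ↦ h2 X (hs.extVanishes_right' (extVanishes_of_injective n) h), fun L _ _ hL ↦ ?_⟩
    obtain ⟨e⟩ := h3 L hL
    obtain ⟨e'⟩ := hs.nonempty_extEquiv' (X := L) (hI' L (hL I hI) n) (extVanishes_of_injective n)
    exact ⟨e'.symm.trans e⟩

end Cosyzygy

section DualOfFiniteLength

open IsLocalRing

variable {R : Type u} [CommRing R] [IsNoetherianRing R] [IsLocalRing R] {r : ℕ}
  (hr : ∀ (X : Type u) [AddCommGroup X] [Module R X] (i : ℕ), r < i → ExtVanishes R X R i)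
  (hxi : xiInvariant R < ⊤)
  {E : Type u} [AddCommGroup E] [Module R E] [Module.Injective R E]
  {j : (R ⧸ maximalIdeal R) →ₗ[R] E} (hj : Function.Injective j)
  {N : Type u} [AddCommGroup N] [Module R N]

include hr hxi hj

/-- If `n + 1` is the only positive degree in which `Ext(S, R)` lives, then `Ext^{n+1}(S, R)` is
resolved by the duals of the modules in a free resolution of `S`, ending with the dual of the
`(n+1)`-st syzygy. The parameter `a` bounds the contribution of `S^*`. -/
lemma extVanishes_extModule (n a : ℕ) {S : Type u} [AddCommGroup S] [Module R S]
    [Module.Finite R S] (hS : ∀ i, i ≠ n → ExtVanishes R S R (i + 1))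
    (hSN : ∀ i, a ≤ i → ExtVanishes R (Module.Dual R S) N i)
    (hV : ExtEventuallyVanishes R S (N →ₗ[R] E)) (i : ℕ) (hi : n + a + 2 ≤ i) :
    ExtVanishes R (Abelian.Ext (ModuleCat.of R S) (ModuleCat.of R R) (n + 1)) N i := by
  induction n generalizing a S with
  | zero =>
    obtain ⟨m, π, hπ⟩ := Module.Finite.exists_fin' R S
    have s := shortExactMaps_ker hπ
    have hZ : IsExtAcyclic R (LinearMap.ker π) :=
      ⟨inferInstance, fun i ↦ s.extVanishes_left (extVanishes_of_projective i)
        (hS (i + 1) i.succ_ne_zero)⟩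
    have hZN := hZ.extVanishes_dual hr hxi hj
      (s.extEventuallyVanishes_left extEventuallyVanishes_of_projective hV)
    obtain ⟨δ, hδ, hδ'⟩ := s.exists_connecting (Y := R) (extVanishes_of_projective 0)
    let res := LinearMap.lcomp R R (LinearMap.ker π).subtype
    have s₁ : ShortExactMaps (C := LinearMap.range res) (LinearMap.lcomp R R π)
        res.rangeRestrict := by
      refine ⟨fun φ ψ h ↦ ?_, fun φ ↦ ⟨fun h ↦ ?_, ?_⟩, res.surjective_rangeRestrict⟩
      · ext x
        obtain ⟨q, rfl⟩ := hπ x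
        exact LinearMap.congr_fun h q
      · exact s.exists_factor φ (congrArg Subtype.val h)
      · rintro ⟨ψ, rfl⟩
        ext x
        simp [res]
    have s₂ : ShortExactMaps (A := LinearMap.range res) (LinearMap.range res).subtype δ :=
      ⟨Subtype.val_injective,
        fun φ ↦ (hδ' φ).trans ⟨fun h ↦ ⟨⟨φ, h⟩, rfl⟩, fun ⟨y, hy⟩ ↦ hy ▸ y.2⟩, hδ⟩
    obtain ⟨i, rfl⟩ := Nat.exists_eq_add_of_le' (show 2 ≤ i by omega)
    exact s₂.extVanishes_right
      (s₁.extVanishes_right (hSN i (by omega)) (extVanishes_of_projective i)) (hZN (i + 1))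
  | succ n ih =>
    obtain ⟨m, π, hπ⟩ := Module.Finite.exists_fin' R S
    have s := shortExactMaps_ker hπ
    have d := s.lcomp (s.exists_extension (hS 0 n.succ_ne_zero.symm))
    obtain ⟨e⟩ := s.nonempty_extEquiv (Y := R) (extVanishes_of_projective n)
      (extVanishes_of_projective (n + 1))
    refine (ih (a + 1) (S := LinearMap.ker π)
      (fun i hi ↦ s.extVanishes_left (extVanishes_of_projective i) (hS (i + 1) (by omega)))
      (fun i hi ↦ ?_) (s.extEventuallyVanishes_left extEventuallyVanishes_of_projective hV)
      (by omega)).congr_left e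
    obtain ⟨i, rfl⟩ := Nat.exists_eq_add_of_le' (show 1 ≤ i by omega)
    exact d.extVanishes_right (hSN i (by omega)) (extVanishes_of_projective i)

/-- The case of a module `L` of grade `r`, where `L^* = 0` unless `r = 0`. -/
lemma extVanishes_extModule_self {L : Type u} [AddCommGroup L] [Module R L] [Module.Finite R L]
    (hL : ∀ i < r, ExtVanishes R L R i) (hV : ExtEventuallyVanishes R L (N →ₗ[R] E)) (i : ℕ)
    (hi : r < i) :
    ExtVanishes R (Abelian.Ext (ModuleCat.of R L) (ModuleCat.of R R) r) N i := by
  cases r with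
  | zero =>
    obtain ⟨i, rfl⟩ := Nat.exists_eq_add_of_le' hi
    have hA : IsExtAcyclic R L := ⟨inferInstance, fun i ↦ hr _ _ i.succ_pos⟩
    exact (hA.extVanishes_dual hr hxi hj hV i).congr_left (extZeroEquiv R L R).symm
  | succ r =>
    have := extVanishes_zero_iff.mp (hL 0 r.succ_pos)
    refine extVanishes_extModule hr hxi hj r 0 (fun i hi ↦ ?_)
      (fun i _ ↦ extVanishes_of_subsingleton i) hV i (by omega)
    rcases lt_or_gt_of_ne hi with h | h
    · exact hL _ (by omega)
    · exact hr _ _ (by omega)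

end DualOfFiniteLength

theorem proposition3p1 {R : Type u} [CommRing R] [IsGorensteinLocalRing R] (d : ℕ)
    (hd : ringKrullDim R = d) (hxi : xiInvariant R < ⊤)
    (M N : Type u) [AddCommGroup M] [Module R M] [AddCommGroup N] [Module R N]
    (hM : IsFiniteLength R M)
    (hNM : ∃ n : ℕ, ∀ i : ℕ, n < i →
      Subsingleton (Abelian.Ext (ModuleCat.of R N) (ModuleCat.of R M) i)) :
    ∀ i : ℕ, d < i →
      Subsingleton (Abelian.Ext (ModuleCat.of R M) (ModuleCat.of R N) i) := by
  intro i hi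
  obtain ⟨r, hrd, hr, hkr, hkr'⟩ := exists_injectiveDimension_eq_depth d hd
  obtain ⟨E, j, hj, _, hess⟩ := exists_injective_hull R (R ⧸ IsLocalRing.maximalIdeal R)
  obtain ⟨hfin, -, hL⟩ := matlisDual_of_isFiniteLength hj hess hM
  obtain ⟨e⟩ := nonempty_matlisBidual_equiv hj hess hM
  have hV : ExtEventuallyVanishes R (M →ₗ[R] E) (N →ₗ[R] E) := by
    obtain ⟨n, hn⟩ := hNM
    refine ⟨n, fun i hi ↦ ?_⟩
    obtain ⟨i, rfl⟩ := Nat.exists_eq_add_of_le' (show 1 ≤ i by omega)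
    exact extVanishes_hom_swap i (ExtVanishes.congr_right (hn _ hi) e)
  have hX := extVanishes_extModule_self hr hxi hj (fun i hi ↦ hL R i (hkr i hi)) hV i (by omega)
  obtain ⟨C, hC, hC', hC''⟩ := exists_cosyzygy r R hkr
  have : Module.Injective R C := module_injective_of_extVanishes_quotient fun I ↦
    hC' _ (hr _ _ r.lt_succ_self)
  obtain ⟨e'⟩ := hC'' (M →ₗ[R] E) fun I _ _ h ↦ hL I 0 h
  -- `k` embeds in `C`, hence so does `E`, as a direct summand
  have hkC : Nontrivial ((R ⧸ IsLocalRing.maximalIdeal R) →ₗ[R] C) := by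
    rw [← not_subsingleton_iff_nontrivial, ← extVanishes_zero_iff]
    exact fun h ↦ hkr' (hC h)
  obtain ⟨φ, hφ⟩ := exists_ne (0 : (R ⧸ IsLocalRing.maximalIdeal R) →ₗ[R] C)
  obtain ⟨s, hs⟩ := Module.Injective.out j hj φ
  have hsi : Function.Injective s := hess.injective_of_comp s <| by
    rw [LinearMap.ext (f := s ∘ₗ j) (g := φ) hs]
    exact (LinearMap.injective_or_eq_zero φ).resolve_right hφ
  obtain ⟨p, hp⟩ := Module.Injective.out s hsi (LinearMap.id : E →ₗ[R] E)
  have hX' : ExtVanishes R ((M →ₗ[R] E) →ₗ[R] E) N i :=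
    (hX.congr_left e').of_retract (LinearMap.llcomp R _ _ _ s) (LinearMap.llcomp R _ _ _ p) <| by
      ext φ x
      exact hp _
  exact hX'.congr_left e.symm
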